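/- Let $N\ge 3$, $2^*=\frac{2N}{N-2}$ and $\Lambda_N=\bigl(\frac{N-2}{2}\bigr)^2$. Let $D^{1,2}(\mathbb R^N)\subset L^{2^*}(\mathbb R^N)$ be the completion of $C_c^\infty(\mathbb R^N)$ in the norm $\bigl(\int_{\mathbb R^N}|\nabla u|^2\,dx\bigr)^{1/2}$. Let $m:\mathbb R^N\to\mathbb R$ be continuous and suppose that the limit $m(\infty)=\lim_{|x|\to\infty}m(x)$ exists and is positive. Put \[ \Lambda_m=\inf\Bigl\{\int_{\mathbb R^N}|\nabla u|^2\,dx:\ u\in D^{1,2}(\mathbb R^N),\ \int_{\mathbb R^N}\frac{m(x)}{|x|^2}u^2\,dx=1\Bigr\} \] and suppose that \[ \Lambda_m<\Lambda_N\,\min\Bigl(\frac1{m(0)},\frac1{m(\infty)}\Bigr), \] where $\frac1{m(0)}$ is read as $+\infty$ if $m(0)\le 0$. Let $\phi_1$ be a principal eigenfunction, that is, a function $\phi_1\in D^{1,2}(\mathbb R^N)$ with $\phi_1>0$ a.e. and $\int_{\mathbb R^N}\frac{m(x)}{|x|^2}\phi_1^2\,dx>0$ that attains $\Lambda_m$: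 \[ \int_{\mathbb R^N}|\nabla \phi_1|^2\,dx=\Lambda_m\int_{\mathbb R^N}\frac{m(x)}{|x|^2}\phi_1^2\,dx . \] Then there exist $\delta>0$ and $R>0$ such that $\phi_1\in L^{2^*(1+\delta)}(\mathbb R^N\setminus B(0,R))$. -/

import Mathlib

open MeasureTheory Filter Topology
open scoped ContDiff ENNReal

/-- The critical Sobolev exponent `2* = 2N/(N-2)` (for `N ≥ 3`). -/
noncomputable def sobolevExponent (N : ℕ) : ℝ := 2 * (N : ℝ) / ((N : ℝ) - 2)

/-- The Hardy constant `Λ_N = ((N-2)/2)^2`. -/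
noncomputable def hardyConstant (N : ℕ) : ℝ := (((N : ℝ) - 2) / 2) ^ 2

/-- `u` belongs to `D^{1,2}(ℝ^N)`, with gradient `G`. Here `D^{1,2}(ℝ^N)` is the completion of
`C_c^∞(ℝ^N)` in the norm `(∫ |∇u|^2)^{1/2}`, realised as a space of functions through the Sobolev
embedding into `L^{2*}(ℝ^N)`: `u` is the `L^{2*}` limit of test functions whose gradients converge
to `G` in `L^2`. -/
structure HasD12Gradient (N : ℕ) (u : EuclideanSpace ℝ (Fin N) → ℝ)
    (G : EuclideanSpace ℝ (Fin N) → EuclideanSpace ℝ (Fin N)) : Prop where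
  memLp_fun : MemLp u (ENNReal.ofReal (sobolevExponent N)) volume
  memLp_grad : MemLp G 2 volume
  exists_approx : ∃ ψ : ℕ → EuclideanSpace ℝ (Fin N) → ℝ,
    (∀ k, ContDiff ℝ ∞ (ψ k) ∧ HasCompactSupport (ψ k)) ∧
    Tendsto (fun k => eLpNorm (fun x => ψ k x - u x)
      (ENNReal.ofReal (sobolevExponent N)) volume) atTop (𝓝 0) ∧
    Tendsto (fun k => eLpNorm (fun x => gradient (ψ k) x - G x) 2 volume) atTop (𝓝 0)

/-- The potential term `∫ m(x) u(x)^2 / |x|^2 dx`. -/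
noncomputable def hardyForm (N : ℕ) (m u : EuclideanSpace ℝ (Fin N) → ℝ) : ℝ :=
  ∫ x, m x / ‖x‖ ^ 2 * u x ^ 2

/-- The Dirichlet energy `∫ |G|^2 dx` of a gradient field `G`. -/
noncomputable def dirichletEnergy (N : ℕ)
    (G : EuclideanSpace ℝ (Fin N) → EuclideanSpace ℝ (Fin N)) : ℝ :=
  ∫ x, ‖G x‖ ^ 2

/-- `Λ_m`, the infimum of `∫ |∇u|^2` over `u ∈ D^{1,2}(ℝ^N)` with `∫ m(x) u^2 / |x|^2 = 1`. -/
noncomputable def principalEigenvalue (N : ℕ) (m : EuclideanSpace ℝ (Fin N) → ℝ) : ℝ :=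
  sInf {t : ℝ | ∃ u G, HasD12Gradient N u G ∧ hardyForm N m u = 1 ∧ t = dirichletEnergy N G}

/-- `φ` is a principal eigenfunction (a positive ground state of finite energy): `φ` is a function
in `D^{1,2}(ℝ^N)`, positive almost everywhere, which minimises the Rayleigh quotient
`∫ |∇u|^2 / ∫ m(x) u^2 / |x|^2` among the `u` with positive denominator. The function is determined
up to a positive factor, so it is not normalised. -/
structure IsPrincipalEigenfunction (N : ℕ) (m φ : EuclideanSpace ℝ (Fin N) → ℝ) : Prop where
  pos : ∀ᵐ x ∂volume, 0 < φ x
  minimizer : ∃ G, HasD12Gradient N φ G ∧ 0 < hardyForm N m φ ∧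
    dirichletEnergy N G / hardyForm N m φ = principalEigenvalue N m

/-!
The proof is a single step of Moser iteration at infinity, with the critical potential absorbed by
Hardy's inequality.

Let `Λ = Λ_m` and let `φ` be the eigenfunction. As a minimizer of the Rayleigh quotient, `φ` solves
`∫ ∇φ · ∇v = Λ ∫ m φ v / ‖x‖ ^ 2` for every `v` in `D^{1,2}` (`weak_eigenvalue_equation`). The
hypothesis on `Λ` gives `Λ m(∞) < Λ_N`, so that `Λ m ≤ θ Λ_N` with some `θ < 1` outside a large
ball. For a smooth cutoff `η` that vanishes on this ball and
`p = ((1 + φ²) / (1 + κ φ²)) ^ (s / 2)`, the equation is tested with `v = η² φ p²`. With `w = η φ p` one has `φ v = w²`, hence Hardy's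
inequality with the sharp constant `Λ_N` (`HasD12Gradient.hardy`) bounds the potential term by
`θ ∫ |∇w|²`. On the other side `∇φ · ∇v` dominates `|∇w|²` up to a factor `1 + O(s²)`, an
arbitrarily small multiple of `|∇w|²` and a term with `|∇η|² φ² (1 + φ²) ^ s`
(`norm_sq_le_pairing`). The last term lives on a bounded set and is integrable because
`2 (1 + s) ≤ 2*`. For small `s` the gradient terms are absorbed, and `∫ |∇w|²` is bounded uniformly
in `κ` (`exists_energy_bound`). Sobolev's inequality and Fatou's lemma as `κ → 0` give
`η φ (1 + φ²) ^ (s / 2) ∈ L^{2*}` (`memLp_mul_one_add_sq_rpow`), which is the claim with `δ = s`.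

The truncation by `κ` is smooth, so the chain rule in `D^{1,2}` is only needed for smooth functions
with bounded derivative (`HasD12Gradient.comp`), where composing the approximating test functions
yields test functions again. Hardy's inequality comes from integrating by parts against the
regularized vector field `x / (‖x‖ ^ 2 + ε)`, which avoids the singularity at the origin
(`hardy_regularized`), and letting `ε → 0` with Fatou's lemma.
-/

/-! ### The critical exponent and gradients of smooth functions -/

theorem sobolevExponent_pos {N : ℕ} (hN : 3 ≤ N) : 0 < sobolevExponent N := by
  have : (3 : ℝ) ≤ N := by exact_mod_cast hN
  unfold sobolevExponent
  apply div_pos <;> linarith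

theorem two_le_sobolevExponent {N : ℕ} (hN : 3 ≤ N) : 2 ≤ sobolevExponent N := by
  have : (3 : ℝ) ≤ N := by exact_mod_cast hN
  unfold sobolevExponent
  rw [le_div_iff₀ (by linarith)]
  linarith

theorem one_le_ofReal_sobolevExponent {N : ℕ} (hN : 3 ≤ N) :
    1 ≤ ENNReal.ofReal (sobolevExponent N) := by
  rw [← ENNReal.ofReal_one]
  exact ENNReal.ofReal_le_ofReal (by linarith [two_le_sobolevExponent hN])

/-- Hölder's inequality puts the product of an `L^{2*}` function and an `L^N` field in `L^2`; this
handles the term `u ∇ζ` in the product rule. -/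
theorem holderTriple_sobolevExponent {N : ℕ} (hN : 3 ≤ N) :
    ENNReal.HolderTriple (ENNReal.ofReal (sobolevExponent N)) (N : ℝ≥0∞) 2 := by
  have h3 : (3 : ℝ) ≤ N := by exact_mod_cast hN
  have h2 : (2 : ℝ≥0∞) = ENNReal.ofReal 2 := by simp
  refine ⟨?_⟩
  rw [← ENNReal.ofReal_natCast, h2, ← ENNReal.ofReal_inv_of_pos (sobolevExponent_pos hN),
    ← ENNReal.ofReal_inv_of_pos (by linarith), ← ENNReal.ofReal_inv_of_pos (by norm_num),
    ← ENNReal.ofReal_add (inv_nonneg.2 (sobolevExponent_pos hN).le) (by positivity)]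
  congr 1
  unfold sobolevExponent
  have : (N : ℝ) - 2 ≠ 0 := by linarith
  have : (N : ℝ) ≠ 0 := by linarith
  field_simp
  ring

section Gradient

variable {V : Type*} [NormedAddCommGroup V] [InnerProductSpace ℝ V] [CompleteSpace V]

theorem norm_gradient_eq_norm_fderiv (f : V → ℝ) (x : V) : ‖gradient f x‖ = ‖fderiv ℝ f x‖ := by
  simp [gradient]

theorem ContDiff.continuous_gradient {f : V → ℝ} (hf : ContDiff ℝ ∞ f) :
    Continuous (gradient f) :=
  (InnerProductSpace.toDual ℝ V).symm.continuous.comp (hf.continuous_fderiv (by simp))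

theorem HasCompactSupport.gradient {f : V → ℝ} (hf : HasCompactSupport f) :
    HasCompactSupport (gradient f) :=
  (hf.fderiv ℝ).comp_left (g := (InnerProductSpace.toDual ℝ V).symm) (map_zero _)

theorem gradient_mul {f g : V → ℝ} {x : V} (hf : DifferentiableAt ℝ f x)
    (hg : DifferentiableAt ℝ g x) :
    gradient (fun y => f y * g y) x = f x • gradient g x + g x • gradient f x := by
  simp only [gradient, fderiv_fun_mul hf hg, map_add, map_smul]

theorem gradient_comp_real {F : ℝ → ℝ} {f : V → ℝ} {x : V} (hF : DifferentiableAt ℝ F (f x))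
    (hf : DifferentiableAt ℝ f x) :
    gradient (fun y => F (f y)) x = deriv F (f x) • gradient f x := by
  have := hF.hasDerivAt.comp_hasFDerivAt x hf.hasFDerivAt
  have h2 : fderiv ℝ (fun y => F (f y)) x = _ := this.fderiv
  simp only [gradient, h2, map_smul]

theorem gradient_add_smul {f g : V → ℝ} {x : V} (c : ℝ) (hf : DifferentiableAt ℝ f x)
    (hg : DifferentiableAt ℝ g x) :
    gradient (fun y => f y + c * g y) x = gradient f x + c • gradient g x := by
  simp only [gradient, fderiv_fun_add hf (hg.const_mul c), fderiv_const_mul hg, map_add, map_smul]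

end Gradient

/-! ### Calculus in `D^{1,2}` -/

section Convergence

variable {α : Type*} {mα : MeasurableSpace α} {μ : Measure α}
variable {V : Type*} [NormedAddCommGroup V]

theorem tendsto_eLpNorm_zero_of_le {f g : ℕ → α → V} {p : ℝ≥0∞} {h : ℕ → ℝ≥0∞}
    (hp : 1 ≤ p) (hf : ∀ k, AEStronglyMeasurable (f k) μ)
    (hg : ∀ k, AEStronglyMeasurable (g k) μ)
    (hf0 : Tendsto (fun k => eLpNorm (f k) p μ) atTop (𝓝 0))
    (hg0 : Tendsto (fun k => eLpNorm (g k) p μ) atTop (𝓝 0))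
    (hh : ∀ k, h k ≤ eLpNorm (fun x => f k x + g k x) p μ) :
    Tendsto h atTop (𝓝 0) := by
  refine tendsto_of_tendsto_of_tendsto_of_le_of_le tendsto_const_nhds
    (by simpa using hf0.add hg0) (fun _ => zero_le) (fun k => ?_)
  exact (hh k).trans (eLpNorm_add_le (hf k) (hg k) hp)

/-- Dominated convergence in `L^2` for a bounded sequence of scalar multipliers. -/
theorem tendsto_eLpNorm_two_smul_zero [NormedSpace ℝ V] {c : ℕ → α → ℝ} {G : α → V} {C : ℝ}
    (hG : MemLp G 2 μ) (hcm : ∀ k, AEStronglyMeasurable (c k) μ) (hcb : ∀ k x, |c k x| ≤ C)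
    (hc : ∀ᵐ x ∂μ, Tendsto (fun k => c k x) atTop (𝓝 0)) :
    Tendsto (fun k => eLpNorm (fun x => c k x • G x) 2 μ) atTop (𝓝 0) := by
  have h2 : ∀ f : α → V, eLpNorm f 2 μ = (∫⁻ x, ‖f x‖ₑ ^ (2 : ℝ) ∂μ) ^ (1 / 2 : ℝ) := by
    intro f
    rw [eLpNorm_eq_lintegral_rpow_enorm_toReal (by norm_num) (by norm_num)]
    simp
  simp only [h2]
  have h0 : (0 : ℝ≥0∞) = 0 ^ (1 / 2 : ℝ) := by norm_num
  rw [h0]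
  refine Tendsto.ennrpow_const _ ?_
  have hfin : ∫⁻ x, ‖G x‖ₑ ^ (2 : ℝ) ∂μ < ⊤ := by
    have := lintegral_rpow_enorm_lt_top_of_eLpNorm_lt_top (by norm_num) (by norm_num) hG.2
    simpa using this
  have key := tendsto_lintegral_of_dominated_convergence' (μ := μ)
    (F := fun k x => ‖c k x • G x‖ₑ ^ (2 : ℝ)) (f := fun _ => 0)
    (fun x => ENNReal.ofReal C ^ (2 : ℝ) * ‖G x‖ₑ ^ (2 : ℝ))
    (fun k => ((hcm k).smul hG.1).enorm.pow_const _) (fun k => Eventually.of_forall fun x => ?_)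
    ?_ ?_
  · simpa using key
  · dsimp only
    rw [enorm_smul, ENNReal.mul_rpow_of_nonneg _ _ (by norm_num)]
    gcongr
    rw [Real.enorm_eq_ofReal_abs]
    exact ENNReal.ofReal_le_ofReal (hcb k x)
  · rw [lintegral_const_mul' _ _ (by simp)]
    exact ENNReal.mul_ne_top (by simp) hfin.ne
  · filter_upwards [hc] with x hx
    have h1 : Tendsto (fun k => ‖c k x • G x‖ₑ) atTop (𝓝 0) := by
      have := (hx.smul_const (G x)).enorm
      simpa using this
    have := h1.ennrpow_const (2 : ℝ)
    simpa using this

end Convergence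

namespace HasD12Gradient

variable {N : ℕ} {u v : EuclideanSpace ℝ (Fin N) → ℝ}
  {G K : EuclideanSpace ℝ (Fin N) → EuclideanSpace ℝ (Fin N)}

theorem add_smul (hN : 3 ≤ N) (hu : HasD12Gradient N u G) (hv : HasD12Gradient N v K) (c : ℝ) :
    HasD12Gradient N (fun x => u x + c * v x) (fun x => G x + c • K x) := by
  obtain ⟨ψ, hψ, hψu, hψG⟩ := hu.exists_approx
  obtain ⟨χ, hχ, hχv, hχK⟩ := hv.exists_approx
  refine ⟨hu.1.add (hv.1.const_mul c), hu.2.add (hv.2.const_smul c),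
    fun k x => ψ k x + c * χ k x, fun k => ⟨(hψ k).1.add (contDiff_const.mul (hχ k).1),
      (hψ k).2.add ((hχ k).2.mul_left)⟩, ?_, ?_⟩
  · refine tendsto_eLpNorm_zero_of_le (one_le_ofReal_sobolevExponent hN)
      (f := fun k x => ψ k x - u x) (g := fun k x => c • (χ k x - v x))
      (fun k => (hψ k).1.continuous.aestronglyMeasurable.sub hu.1.1)
      (fun k => ((hχ k).1.continuous.aestronglyMeasurable.sub hv.1.1).const_smul c)
      hψu ?_ (fun k => le_of_eq (by congr 1; ext x; simp only [smul_eq_mul]; ring))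
    have := ENNReal.Tendsto.const_mul (a := ‖c‖ₑ) hχv (Or.inr (by simp))
    simp only [mul_zero] at this
    refine this.congr fun k => ?_
    exact (eLpNorm_const_smul c _ _ _).symm
  · refine tendsto_eLpNorm_zero_of_le (p := 2) (by norm_num)
      (f := fun k x => gradient (ψ k) x - G x) (g := fun k x => c • (gradient (χ k) x - K x))
      (fun k => (hψ k).1.continuous_gradient.aestronglyMeasurable.sub hu.2.1)
      (fun k => ((hχ k).1.continuous_gradient.aestronglyMeasurable.sub hv.2.1).const_smul c)
      hψG ?_ (fun k => le_of_eq ?_)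
    · have := ENNReal.Tendsto.const_mul (a := ‖c‖ₑ) hχK (Or.inr (by simp))
      simp only [mul_zero] at this
      refine this.congr fun k => ?_
      exact (eLpNorm_const_smul c _ _ _).symm
    · congr 1
      ext1 x
      rw [gradient_add_smul c ((hψ k).1.differentiable (by simp) x)
        ((hχ k).1.differentiable (by simp) x), smul_sub]
      abel

/-- A subsequence of the approximating test functions also converges almost everywhere. -/
theorem exists_approx_ae (hN : 3 ≤ N) (hu : HasD12Gradient N u G) :
    ∃ ψ : ℕ → EuclideanSpace ℝ (Fin N) → ℝ,
    (∀ k, ContDiff ℝ ∞ (ψ k) ∧ HasCompactSupport (ψ k)) ∧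
    Tendsto (fun k => eLpNorm (fun x => ψ k x - u x)
      (ENNReal.ofReal (sobolevExponent N)) volume) atTop (𝓝 0) ∧
    Tendsto (fun k => eLpNorm (fun x => gradient (ψ k) x - G x) 2 volume) atTop (𝓝 0) ∧
    ∀ᵐ x, Tendsto (fun k => ψ k x) atTop (𝓝 (u x)) := by
  obtain ⟨ψ, hψ, hψu, hψG⟩ := hu.exists_approx
  have h := tendstoInMeasure_of_tendsto_eLpNorm (f := ψ) (g := u)
    (by simpa using sobolevExponent_pos hN)
    (fun k => (hψ k).1.continuous.aestronglyMeasurable) hu.1.1 hψu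
  obtain ⟨ns, hns, hae⟩ := h.exists_seq_tendsto_ae
  exact ⟨fun k => ψ (ns k), fun k => hψ _, hψu.comp hns.tendsto_atTop,
    hψG.comp hns.tendsto_atTop, hae⟩

/-- Chain rule in `D^{1,2}`. -/
theorem comp (hN : 3 ≤ N) (hu : HasD12Gradient N u G) {F : ℝ → ℝ} (hF : ContDiff ℝ ∞ F)
    (hF0 : F 0 = 0) {C : ℝ} (hC : ∀ t, |deriv F t| ≤ C) :
    HasD12Gradient N (fun x => F (u x)) (fun x => deriv F (u x) • G x) := by
  obtain ⟨ψ, hψ, hψu, hψG, hae⟩ := hu.exists_approx_ae hN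
  have hFd : Differentiable ℝ F := hF.differentiable (by simp)
  have hF' : Continuous (deriv F) := hF.continuous_deriv (by simp)
  have hlip : ∀ a b, |F a - F b| ≤ C * |a - b| := fun a b => by
    have := Convex.norm_image_sub_le_of_norm_deriv_le (f := F) (C := C) (s := Set.univ)
      (fun x _ => hFd x) (fun x _ => hC x) convex_univ (Set.mem_univ b) (Set.mem_univ a)
    simpa using this
  have hu1 : AEStronglyMeasurable (fun x => F (u x)) volume :=
    hF.continuous.comp_aestronglyMeasurable hu.1.1
  have hd1 : AEStronglyMeasurable (fun x => deriv F (u x)) volume :=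
    hF'.comp_aestronglyMeasurable hu.1.1
  refine ⟨hu.1.of_le_mul (c := C) hu1 (Eventually.of_forall fun x => by
      simpa [hF0] using hlip (u x) 0),
    hu.2.of_le_mul (c := C) (hd1.smul hu.2.1) (Eventually.of_forall fun x => ?_),
    fun k x => F (ψ k x), fun k => ⟨hF.comp (hψ k).1, (hψ k).2.comp_left hF0⟩, ?_, ?_⟩
  · rw [norm_smul]
    gcongr
    exact hC _
  · refine tendsto_of_tendsto_of_tendsto_of_le_of_le tendsto_const_nhds
      (by simpa using ENNReal.Tendsto.const_mul (a := ENNReal.ofReal C) hψu (Or.inr (by simp)))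
      (fun _ => zero_le) (fun k => ?_)
    exact eLpNorm_le_mul_eLpNorm_of_ae_le_mul (Eventually.of_forall fun x => hlip _ _) _
  · refine tendsto_eLpNorm_zero_of_le (p := 2) (by norm_num)
      (f := fun k x => deriv F (ψ k x) • (gradient (ψ k) x - G x))
      (g := fun k x => (deriv F (ψ k x) - deriv F (u x)) • G x)
      (fun k => (hF'.comp (hψ k).1.continuous).aestronglyMeasurable.smul
        ((hψ k).1.continuous_gradient.aestronglyMeasurable.sub hu.2.1))
      (fun k => ((hF'.comp (hψ k).1.continuous).aestronglyMeasurable.sub hd1).smul hu.2.1)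
      ?_ ?_ (fun k => le_of_eq ?_)
    · refine tendsto_of_tendsto_of_tendsto_of_le_of_le tendsto_const_nhds
        (by simpa using ENNReal.Tendsto.const_mul (a := ENNReal.ofReal C) hψG (Or.inr (by simp)))
        (fun _ => zero_le) (fun k => ?_)
      refine eLpNorm_le_mul_eLpNorm_of_ae_le_mul (Eventually.of_forall fun x => ?_) _
      rw [norm_smul]
      gcongr
      exact hC _
    · refine tendsto_eLpNorm_two_smul_zero (C := C + C) hu.2
        (fun k => (hF'.comp (hψ k).1.continuous).aestronglyMeasurable.sub hd1)
        (fun k x => (abs_sub _ _).trans (add_le_add (hC _) (hC _))) ?_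
      filter_upwards [hae] with x hx
      have := ((hF'.tendsto (u x)).comp hx).sub_const (deriv F (u x))
      simpa using this
    · congr 1
      ext1 x
      rw [gradient_comp_real (hFd _) ((hψ k).1.differentiable (by simp) x), smul_sub, sub_smul]
      abel

/-- Product rule in `D^{1,2}` for a bounded smooth factor with compactly supported gradient. -/
theorem smooth_mul (hN : 3 ≤ N) (hu : HasD12Gradient N u G)
    {ζ : EuclideanSpace ℝ (Fin N) → ℝ} (hζ : ContDiff ℝ ∞ ζ) {C : ℝ} (hC : ∀ x, |ζ x| ≤ C)
    (hζc : HasCompactSupport (gradient ζ)) :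
    HasD12Gradient N (fun x => ζ x * u x) (fun x => ζ x • G x + u x • gradient ζ x) := by
  obtain ⟨ψ, hψ, hψu, hψG⟩ := hu.exists_approx
  have hT := holderTriple_sobolevExponent hN
  have hgm : MemLp (gradient ζ) (N : ℝ≥0∞) volume :=
    hζ.continuous_gradient.memLp_of_hasCompactSupport hζc
  have hζm : AEStronglyMeasurable ζ volume := hζ.continuous.aestronglyMeasurable
  have hb1 : MemLp (fun x => ζ x * u x) (ENNReal.ofReal (sobolevExponent N)) volume :=
    hu.1.of_le_mul (c := C) (hζm.mul hu.1.1) (Eventually.of_forall fun x => by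
      rw [norm_mul]
      gcongr
      exact hC _)
  have hb2 : MemLp (fun x => ζ x • G x) 2 volume :=
    hu.2.of_le_mul (c := C) (hζm.smul hu.2.1) (Eventually.of_forall fun x => by
      rw [norm_smul]
      gcongr
      exact hC _)
  refine ⟨hb1, hb2.add (hgm.smul hu.1), fun k x => ζ x * ψ k x,
    fun k => ⟨hζ.mul (hψ k).1, (hψ k).2.mul_left⟩, ?_, ?_⟩
  · refine tendsto_of_tendsto_of_tendsto_of_le_of_le tendsto_const_nhds
      (by simpa using ENNReal.Tendsto.const_mul (a := ENNReal.ofReal C) hψu (Or.inr (by simp)))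
      (fun _ => zero_le) (fun k => ?_)
    refine eLpNorm_le_mul_eLpNorm_of_ae_le_mul (Eventually.of_forall fun x => ?_) _
    rw [← mul_sub, norm_mul]
    gcongr
    exact hC _
  · refine tendsto_eLpNorm_zero_of_le (p := 2) (by norm_num)
      (f := fun k x => ζ x • (gradient (ψ k) x - G x))
      (g := fun k x => (ψ k x - u x) • gradient ζ x)
      (fun k => hζm.smul ((hψ k).1.continuous_gradient.aestronglyMeasurable.sub hu.2.1))
      (fun k => ((hψ k).1.continuous.aestronglyMeasurable.sub hu.1.1).smul hgm.1)
      ?_ ?_ (fun k => le_of_eq ?_)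
    · refine tendsto_of_tendsto_of_tendsto_of_le_of_le tendsto_const_nhds
        (by simpa using ENNReal.Tendsto.const_mul (a := ENNReal.ofReal C) hψG (Or.inr (by simp)))
        (fun _ => zero_le) (fun k => ?_)
      refine eLpNorm_le_mul_eLpNorm_of_ae_le_mul (Eventually.of_forall fun x => ?_) _
      rw [norm_smul]
      gcongr
      exact hC _
    · have hlim := ENNReal.Tendsto.mul_const (b := eLpNorm (gradient ζ) (N : ℝ≥0∞) volume)
        hψu (Or.inr hgm.2.ne)
      rw [zero_mul] at hlim
      refine tendsto_of_tendsto_of_tendsto_of_le_of_le tendsto_const_nhds hlim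
        (fun _ => zero_le) (fun k => ?_)
      exact eLpNorm_smul_le_mul_eLpNorm (p := ENNReal.ofReal (sobolevExponent N))
        (q := (N : ℝ≥0∞)) (r := 2) (φ := fun x => ψ k x - u x) (f := gradient ζ) hgm.1
        ((hψ k).1.continuous.aestronglyMeasurable.sub hu.1.1)
    · congr 1
      ext1 x
      rw [gradient_mul (hζ.differentiable (by simp) x) ((hψ k).1.differentiable (by simp) x),
        smul_sub, sub_smul]
      abel

end HasD12Gradient

/-- Sobolev inequality in `D^{1,2}`. -/
theorem exists_sobolev_const {N : ℕ} (hN : 3 ≤ N) : ∃ C : ℝ≥0∞, C ≠ ⊤ ∧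
    ∀ u G, HasD12Gradient N u G →
      eLpNorm u (ENNReal.ofReal (sobolevExponent N)) volume ≤ C * eLpNorm G 2 volume := by
  have h3 : (3 : ℝ) ≤ N := by exact_mod_cast hN
  refine ⟨SNormLESNormFDerivOfEqConst ℝ (volume : Measure (EuclideanSpace ℝ (Fin N))) 2,
    by simp, fun u G hu => ?_⟩
  set S := SNormLESNormFDerivOfEqConst ℝ (volume : Measure (EuclideanSpace ℝ (Fin N))) 2
  obtain ⟨ψ, hψ, hψu, hψG⟩ := hu.exists_approx
  have hk : ∀ k, eLpNorm u (ENNReal.ofReal (sobolevExponent N)) volume ≤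
      eLpNorm (fun x => ψ k x - u x) (ENNReal.ofReal (sobolevExponent N)) volume +
      S * (eLpNorm (fun x => gradient (ψ k) x - G x) 2 volume + eLpNorm G 2 volume) := by
    intro k
    have hψm : AEStronglyMeasurable (ψ k) volume := (hψ k).1.continuous.aestronglyMeasurable
    have hgm : AEStronglyMeasurable (gradient (ψ k)) volume :=
      (hψ k).1.continuous_gradient.aestronglyMeasurable
    have h1 : eLpNorm u (ENNReal.ofReal (sobolevExponent N)) volume ≤
        eLpNorm (u - ψ k) (ENNReal.ofReal (sobolevExponent N)) volume +
        eLpNorm (ψ k) (ENNReal.ofReal (sobolevExponent N)) volume := by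
      have := eLpNorm_add_le (hu.1.1.sub hψm) hψm (one_le_ofReal_sobolevExponent hN)
      simpa using this
    rw [eLpNorm_sub_comm] at h1
    have h2 : eLpNorm (gradient (ψ k)) 2 volume ≤
        eLpNorm (gradient (ψ k) - G) 2 volume + eLpNorm G 2 volume := by
      have := eLpNorm_add_le (hgm.sub hu.2.1) hu.2.1 (p := 2) (by norm_num)
      simpa using this
    have h3' : eLpNorm (ψ k) (ENNReal.ofReal (sobolevExponent N)) volume ≤
        S * eLpNorm (gradient (ψ k)) 2 volume := by
      have := eLpNorm_le_eLpNorm_fderiv_of_eq (volume : Measure (EuclideanSpace ℝ (Fin N)))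
        (u := ψ k) (p := 2)
        (p' := (sobolevExponent N).toNNReal) ((hψ k).1.of_le (by simp)) (hψ k).2 (by norm_num)
        (by simp; omega) (by
          rw [Real.coe_toNNReal _ (sobolevExponent_pos hN).le, finrank_euclideanSpace_fin]
          unfold sobolevExponent
          have : (N : ℝ) - 2 ≠ 0 := by linarith
          have : (N : ℝ) ≠ 0 := by linarith
          push_cast
          field_simp)
      refine this.trans_eq ?_
      congr 1
      exact eLpNorm_congr_norm_ae (f := fderiv ℝ (ψ k)) (Eventually.of_forall fun x =>
        (norm_gradient_eq_norm_fderiv _ _).symm)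
    refine h1.trans (add_le_add le_rfl (h3'.trans ?_))
    gcongr
    exact h2
  have hlim := hψu.add (ENNReal.Tendsto.const_mul (a := (S : ℝ≥0∞))
    (hψG.add_const (eLpNorm G 2 volume)) (Or.inr (by simp)))
  simp only [zero_add] at hlim
  exact ge_of_tendsto' hlim hk

/-! ### Hardy's inequality -/

theorem MeasureTheory.MemLp.eLpNorm_two_eq {α V : Type*} {mα : MeasurableSpace α} {μ : Measure α}
    [NormedAddCommGroup V] {f : α → V} (hf : MemLp f 2 μ) :
    eLpNorm f 2 μ = ENNReal.ofReal (√(∫ x, ‖f x‖ ^ 2 ∂μ)) := by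
  rw [hf.eLpNorm_eq_integral_rpow_norm (by norm_num) (by norm_num), Real.sqrt_eq_rpow]
  simp

theorem hardyConstant_pos {N : ℕ} (hN : 3 ≤ N) : 0 < hardyConstant N := by
  have h3 : (3 : ℝ) ≤ N := by exact_mod_cast hN
  have : (0 : ℝ) < N - 2 := by linarith
  unfold hardyConstant
  positivity

/-- Integration by parts of `u ^ 2` against the vector field `x / (‖x‖ ^ 2 + ε)`. -/
theorem integral_div_regularized_field_eq_zero {N : ℕ} {u : EuclideanSpace ℝ (Fin N) → ℝ}
    (hu : ContDiff ℝ ∞ u) (huc : HasCompactSupport u) {ε : ℝ} (hε : 0 < ε) :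
    ∫ x, ((N / (‖x‖ ^ 2 + ε) - 2 * ‖x‖ ^ 2 / (‖x‖ ^ 2 + ε) ^ 2) * u x ^ 2 +
      2 * u x * inner ℝ (gradient u x) x / (‖x‖ ^ 2 + ε)) = 0 := by
  have hpos : ∀ x : EuclideanSpace ℝ (Fin N), 0 < ‖x‖ ^ 2 + ε := fun x => by positivity
  have hne : ∀ x : EuclideanSpace ℝ (Fin N), ‖x‖ ^ 2 + ε ≠ 0 := fun x => (hpos x).ne'
  have hud : Differentiable ℝ u := hu.differentiable (by simp)
  have hu' : Continuous (fderiv ℝ u) := hu.continuous_fderiv (by simp)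
  set e : Fin N → EuclideanSpace ℝ (Fin N) := fun i => EuclideanSpace.single i 1 with he
  have hf : ∀ i (x : EuclideanSpace ℝ (Fin N)),
      HasFDerivAt (fun y : EuclideanSpace ℝ (Fin N) => y i * (‖y‖ ^ 2 + ε)⁻¹)
        (x i • (-((‖x‖ ^ 2 + ε) ^ 2)⁻¹ • (2 • innerSL ℝ x)) +
          (‖x‖ ^ 2 + ε)⁻¹ • (EuclideanSpace.proj i : EuclideanSpace ℝ (Fin N) →L[ℝ] ℝ)) x := by
    intro i x
    have h1 : HasFDerivAt (fun y : EuclideanSpace ℝ (Fin N) => y i)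
      (EuclideanSpace.proj i : EuclideanSpace ℝ (Fin N) →L[ℝ] ℝ) x :=
      (EuclideanSpace.proj i : EuclideanSpace ℝ (Fin N) →L[ℝ] ℝ).hasFDerivAt
    have h2 : HasFDerivAt (fun y : EuclideanSpace ℝ (Fin N) => ‖y‖ ^ 2 + ε)
      (2 • innerSL ℝ x) x := (hasStrictFDerivAt_norm_sq x).hasFDerivAt.add_const ε
    have h3 := (hasDerivAt_inv (hne x)).comp_hasFDerivAt x h2
    exact h1.mul h3
  have hfe : ∀ i (x : EuclideanSpace ℝ (Fin N)),
      fderiv ℝ (fun y : EuclideanSpace ℝ (Fin N) => y i * (‖y‖ ^ 2 + ε)⁻¹) x (e i) =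
        (‖x‖ ^ 2 + ε)⁻¹ - 2 * x i ^ 2 / (‖x‖ ^ 2 + ε) ^ 2 := by
    intro i x
    rw [(hf i x).fderiv]
    simp [he, EuclideanSpace.inner_single_right]
    field_simp
    ring
  have hge : ∀ i (x : EuclideanSpace ℝ (Fin N)),
      fderiv ℝ (fun y => u y ^ 2) x (e i) = 2 * u x * fderiv ℝ u x (e i) := by
    intro i x
    rw [((hud x).hasFDerivAt.pow 2).fderiv]
    simp
  have hcont : Continuous fun x : EuclideanSpace ℝ (Fin N) => ‖x‖ ^ 2 + ε := by fun_prop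
  have hcinv : Continuous fun x : EuclideanSpace ℝ (Fin N) => (‖x‖ ^ 2 + ε)⁻¹ := hcont.inv₀ hne
  have hc2 : Continuous fun x : EuclideanSpace ℝ (Fin N) => ((‖x‖ ^ 2 + ε) ^ 2)⁻¹ :=
    (hcont.pow 2).inv₀ (fun x => pow_ne_zero 2 (hne x))
  have huc2 : HasCompactSupport fun x => u x ^ 2 :=
    huc.comp_left (g := fun t : ℝ => t ^ 2) (by norm_num)
  have hci : ∀ i, Continuous fun x : EuclideanSpace ℝ (Fin N) => x i := fun i => by fun_prop
  have hcu := hu.continuous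
  have hfu : ∀ i, Continuous fun x => fderiv ℝ u x (e i) := fun i => by fun_prop
  have I1 : ∀ i, Integrable (fun x : EuclideanSpace ℝ (Fin N) =>
      ((‖x‖ ^ 2 + ε)⁻¹ - 2 * x i ^ 2 / (‖x‖ ^ 2 + ε) ^ 2) * u x ^ 2) volume := fun i => by
    refine Continuous.integrable_of_hasCompactSupport ?_ huc2.mul_left
    simp only [div_eq_mul_inv]
    fun_prop
  have I2 : ∀ i, Integrable (fun x : EuclideanSpace ℝ (Fin N) =>
      x i * (‖x‖ ^ 2 + ε)⁻¹ * (2 * u x * fderiv ℝ u x (e i))) volume := fun i => by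
    refine Continuous.integrable_of_hasCompactSupport ?_
      (HasCompactSupport.mul_left (HasCompactSupport.mul_right (huc.mul_left)))
    fun_prop
  have I3 : ∀ i, Integrable (fun x : EuclideanSpace ℝ (Fin N) =>
      x i * (‖x‖ ^ 2 + ε)⁻¹ * u x ^ 2) volume := fun i => by
    refine Continuous.integrable_of_hasCompactSupport ?_ huc2.mul_left
    fun_prop
  have key : ∀ i, ∫ x : EuclideanSpace ℝ (Fin N),
      (((‖x‖ ^ 2 + ε)⁻¹ - 2 * x i ^ 2 / (‖x‖ ^ 2 + ε) ^ 2) * u x ^ 2 +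
        x i * (‖x‖ ^ 2 + ε)⁻¹ * (2 * u x * fderiv ℝ u x (e i))) = 0 := by
    intro i
    have := integral_mul_fderiv_eq_neg_fderiv_mul_of_integrable
      (μ := (volume : Measure (EuclideanSpace ℝ (Fin N)))) (v := e i)
      (f := fun y : EuclideanSpace ℝ (Fin N) => y i * (‖y‖ ^ 2 + ε)⁻¹) (g := fun y => u y ^ 2)
      (by simpa only [hfe] using I1 i) (by simpa only [hge] using I2 i) (I3 i)
      (fun x _ => (hf i x).differentiableAt) (fun x _ => (hud x).pow 2)
    simp only [hfe, hge] at this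
    rw [integral_add (I1 i) (I2 i), this]
    ring
  have hsum := integral_finsetSum (μ := (volume : Measure (EuclideanSpace ℝ (Fin N))))
    Finset.univ (fun i _ => (I1 i).add (I2 i))
  simp only [Pi.add_apply, key, Finset.sum_const_zero] at hsum
  rw [← hsum]
  congr 1
  ext1 x
  have hx2 : ∑ i, x i ^ 2 = ‖x‖ ^ 2 := by
    rw [EuclideanSpace.norm_sq_eq]
    simp
  have hxg : ∑ i, x i * fderiv ℝ u x (e i) = inner ℝ (gradient u x) x := by
    rw [inner_gradient_left]
    refine Eq.trans ?_ (congrArg (fderiv ℝ u x)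
      ((EuclideanSpace.basisFun (Fin N) ℝ).sum_repr x))
    simp [he]
  rw [← hxg, Finset.sum_add_distrib, ← Finset.sum_mul, Finset.sum_sub_distrib, ← Finset.sum_div,
    ← Finset.mul_sum, hx2]
  simp only [Finset.sum_const, Finset.card_univ, Fintype.card_fin, nsmul_eq_mul]
  congr 1
  rw [Finset.mul_sum, Finset.sum_div]
  refine Finset.sum_congr rfl fun i _ => ?_
  ring

/-- Hardy's inequality for test functions, with the weight `1 / ‖x‖` replaced by the bounded weight
`‖x‖ / (‖x‖ ^ 2 + ε)`; the constant is already the sharp one and does not depend on `ε`. -/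
theorem hardy_regularized {N : ℕ} (hN : 3 ≤ N) {u : EuclideanSpace ℝ (Fin N) → ℝ}
    (hu : ContDiff ℝ ∞ u) (huc : HasCompactSupport u) {ε : ℝ} (hε : 0 < ε) :
    eLpNorm (fun x => ((N : ℝ) - 2) / 2 * ‖x‖ / (‖x‖ ^ 2 + ε) * u x) 2 volume ≤
      eLpNorm (gradient u) 2 volume := by
  have h3 : (3 : ℝ) ≤ N := by exact_mod_cast hN
  have hpos : ∀ x : EuclideanSpace ℝ (Fin N), 0 < ‖x‖ ^ 2 + ε := fun x => by positivity
  have hne : ∀ x : EuclideanSpace ℝ (Fin N), ‖x‖ ^ 2 + ε ≠ 0 := fun x => (hpos x).ne'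
  have hcont : Continuous fun x : EuclideanSpace ℝ (Fin N) => ‖x‖ ^ 2 + ε := by fun_prop
  have hcinv : Continuous fun x : EuclideanSpace ℝ (Fin N) => (‖x‖ ^ 2 + ε)⁻¹ := hcont.inv₀ hne
  have hc2 : Continuous fun x : EuclideanSpace ℝ (Fin N) => ((‖x‖ ^ 2 + ε) ^ 2)⁻¹ :=
    (hcont.pow 2).inv₀ (fun x => pow_ne_zero 2 (hne x))
  have hcu := hu.continuous
  have hcg := hu.continuous_gradient
  have hm1 : MemLp (fun x : EuclideanSpace ℝ (Fin N) =>
      ((N : ℝ) - 2) / 2 * ‖x‖ / (‖x‖ ^ 2 + ε) * u x) 2 volume := by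
    refine Continuous.memLp_of_hasCompactSupport ?_ huc.mul_left
    simp only [div_eq_mul_inv _ (‖_‖ ^ 2 + ε)]
    fun_prop
  have hm2 : MemLp (gradient u) 2 volume := hcg.memLp_of_hasCompactSupport huc.gradient
  rw [hm1.eLpNorm_two_eq, hm2.eLpNorm_two_eq]
  refine ENNReal.ofReal_le_ofReal (Real.sqrt_le_sqrt ?_)
  have J1 := (memLp_two_iff_integrable_sq_norm hm1.1).1 hm1
  have J2 := (memLp_two_iff_integrable_sq_norm hm2.1).1 hm2
  have J3 : Integrable (fun x : EuclideanSpace ℝ (Fin N) =>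
      (N / (‖x‖ ^ 2 + ε) - 2 * ‖x‖ ^ 2 / (‖x‖ ^ 2 + ε) ^ 2) * u x ^ 2 +
      2 * u x * inner ℝ (gradient u x) x / (‖x‖ ^ 2 + ε)) volume := by
    refine Continuous.integrable_of_hasCompactSupport ?_ (HasCompactSupport.add ?_ ?_)
    · simp only [div_eq_mul_inv]
      fun_prop
    · exact (huc.comp_left (g := fun t : ℝ => t ^ 2) (by norm_num)).mul_left
    · simp only [div_eq_mul_inv]
      exact ((huc.mul_left).mul_right).mul_right
  have hmono : ∫ x, (((N : ℝ) - 2) / 2)⁻¹ *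
      (‖((N : ℝ) - 2) / 2 * ‖x‖ / (‖x‖ ^ 2 + ε) * u x‖ ^ 2 - ‖gradient u x‖ ^ 2) ≤
      ∫ x : EuclideanSpace ℝ (Fin N),
        ((N / (‖x‖ ^ 2 + ε) - 2 * ‖x‖ ^ 2 / (‖x‖ ^ 2 + ε) ^ 2) * u x ^ 2 +
        2 * u x * inner ℝ (gradient u x) x / (‖x‖ ^ 2 + ε)) := by
    refine integral_mono ((J1.sub J2).const_mul _) J3 fun x => ?_
    have hin : |inner ℝ (gradient u x) x| ≤ ‖gradient u x‖ * ‖x‖ := abs_real_inner_le_norm _ _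
    dsimp only
    set r := ‖x‖
    set g := ‖gradient u x‖
    set I := inner ℝ (gradient u x) x
    set d := r ^ 2 + ε with hd
    have hd0 : 0 < d := hpos x
    set c := ((N : ℝ) - 2) / 2 with hc
    have hc0 : 0 < c := by rw [hc]; linarith
    have hNc : (N : ℝ) = 2 * c + 2 := by rw [hc]; ring
    rw [hNc, Real.norm_eq_abs, sq_abs]
    have e1 : c⁻¹ * ((c * r / d * u x) ^ 2 - g ^ 2) = c * (r / d * |u x|) ^ 2 - c⁻¹ * g ^ 2 := by
      rw [mul_pow (r / d), sq_abs]
      field_simp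
    have e2 : ((2 * c + 2) / d - 2 * r ^ 2 / d ^ 2) * u x ^ 2 =
        2 * c * (r / d * |u x|) ^ 2 + (2 * c + 2) * ε / d ^ 2 * u x ^ 2 := by
      rw [mul_pow (r / d), sq_abs]
      have : ε = d - r ^ 2 := by rw [hd]; ring
      rw [this]
      field_simp
      ring
    have e3 : -(2 * (r / d * |u x|) * g) ≤ 2 * u x * I / d := by
      have : |2 * u x * I / d| ≤ 2 * (r / d * |u x|) * g := by
        rw [abs_div, abs_mul, abs_mul, abs_of_pos hd0, abs_two]
        calc 2 * |u x| * |I| / d ≤ 2 * |u x| * (g * r) / d := by gcongr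
          _ = _ := by ring
      exact (neg_le_neg this).trans (neg_abs_le _)
    have e4 : 0 ≤ (2 * c + 2) * ε / d ^ 2 * u x ^ 2 := by positivity
    -- Young's inequality with weight `c = (N - 2) / 2` produces the sharp constant.
    have e5 : 0 ≤ c * (r / d * |u x|) ^ 2 + c⁻¹ * g ^ 2 - 2 * (r / d * |u x|) * g := by
      have : c * (r / d * |u x|) ^ 2 + c⁻¹ * g ^ 2 - 2 * (r / d * |u x|) * g =
          c⁻¹ * (c * (r / d * |u x|) - g) ^ 2 := by
        field_simp
        ring
      rw [this]
      positivity
    rw [e1, e2]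
    linarith
  rw [integral_div_regularized_field_eq_zero hu huc hε, integral_const_mul,
    integral_sub J1 J2] at hmono
  have hc0 : (0 : ℝ) < (((N : ℝ) - 2) / 2)⁻¹ := by
    have : (0 : ℝ) < N - 2 := by linarith
    positivity
  have := nonpos_of_mul_nonpos_right hmono hc0
  linarith

/-- Hardy's inequality in `D^{1,2}` with its sharp constant. -/
theorem HasD12Gradient.hardy_eLpNorm {N : ℕ} (hN : 3 ≤ N) {u : EuclideanSpace ℝ (Fin N) → ℝ}
    {G : EuclideanSpace ℝ (Fin N) → EuclideanSpace ℝ (Fin N)} (hu : HasD12Gradient N u G) :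
    eLpNorm (fun x => ((N : ℝ) - 2) / 2 * (u x / ‖x‖)) 2 volume ≤ eLpNorm G 2 volume := by
  obtain ⟨ψ, hψ, -, hψG, hae⟩ := hu.exists_approx_ae hN
  have hε : ∀ k : ℕ, (0 : ℝ) < 1 / (k + 1) := fun k => by positivity
  have hlim : Tendsto (fun k => eLpNorm (fun x => gradient (ψ k) x - G x) 2 volume +
      eLpNorm G 2 volume) atTop (𝓝 (eLpNorm G 2 volume)) := by
    simpa using hψG.add_const (eLpNorm G 2 volume)
  rw [← hlim.liminf_eq]
  refine (Lp.eLpNorm_lim_le_liminf_eLpNorm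
    (f := fun k x => ((N : ℝ) - 2) / 2 * ‖x‖ / (‖x‖ ^ 2 + 1 / ((k : ℝ) + 1)) * ψ k x)
    (fun k => ?_) _ ?_).trans (liminf_le_liminf (Eventually.of_forall fun k => ?_))
  · have hc := (hψ k).1.continuous.measurable
    exact Measurable.aestronglyMeasurable (by fun_prop)
  · filter_upwards [hae] with x hx
    have h1 : Tendsto (fun k : ℕ => ‖x‖ ^ 2 + 1 / ((k : ℝ) + 1)) atTop (𝓝 (‖x‖ ^ 2)) := by
      simpa using tendsto_one_div_add_atTop_nhds_zero_nat.const_add (‖x‖ ^ 2)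
    rcases eq_or_ne x 0 with rfl | hx0
    -- At the origin the regularized weight and `1 / ‖x‖` both vanish, the latter by convention.
    · simp
    · have hn : ‖x‖ ≠ 0 := norm_ne_zero_iff.2 hx0
      have := ((tendsto_const_nhds (x := ((N : ℝ) - 2) / 2 * ‖x‖)).div h1
        (pow_ne_zero 2 hn)).mul hx
      have e : ((N : ℝ) - 2) / 2 * (u x / ‖x‖) = ((N : ℝ) - 2) / 2 * ‖x‖ / ‖x‖ ^ 2 * u x := by
        field_simp
      rw [e]
      exact this
  · refine (hardy_regularized hN (hψ k).1 (hψ k).2 (hε k)).trans ?_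
    have hgm : AEStronglyMeasurable (gradient (ψ k)) volume :=
      (hψ k).1.continuous_gradient.aestronglyMeasurable
    have := eLpNorm_add_le (hgm.sub hu.2.1) hu.2.1 (p := 2) (by norm_num)
    rw [sub_add_cancel] at this
    exact this

theorem HasD12Gradient.memLp_div_norm {N : ℕ} (hN : 3 ≤ N) {u : EuclideanSpace ℝ (Fin N) → ℝ}
    {G : EuclideanSpace ℝ (Fin N) → EuclideanSpace ℝ (Fin N)} (hu : HasD12Gradient N u G) :
    MemLp (fun x => u x / ‖x‖) 2 volume := by
  have h3 : (3 : ℝ) ≤ N := by exact_mod_cast hN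
  have hc : ((N : ℝ) - 2) / 2 ≠ 0 := by
    have : (0 : ℝ) < N - 2 := by linarith
    positivity
  have hm : AEStronglyMeasurable (fun x => u x / ‖x‖) volume :=
    (hu.1.1.aemeasurable.div measurable_norm.aemeasurable).aestronglyMeasurable
  have h1 : MemLp (fun x => ((N : ℝ) - 2) / 2 * (u x / ‖x‖)) 2 volume :=
    ⟨hm.const_mul _, (hu.hardy_eLpNorm hN).trans_lt hu.2.2⟩
  have h2 := h1.const_mul (((N : ℝ) - 2) / 2)⁻¹
  simpa only [inv_mul_cancel_left₀ hc] using h2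

theorem HasD12Gradient.hardy {N : ℕ} (hN : 3 ≤ N) {u : EuclideanSpace ℝ (Fin N) → ℝ}
    {G : EuclideanSpace ℝ (Fin N) → EuclideanSpace ℝ (Fin N)} (hu : HasD12Gradient N u G) :
    hardyConstant N * ∫ x, (u x / ‖x‖) ^ 2 ≤ dirichletEnergy N G := by
  have h := hu.hardy_eLpNorm hN
  rw [((hu.memLp_div_norm hN).const_mul _).eLpNorm_two_eq, hu.2.eLpNorm_two_eq,
    ENNReal.ofReal_le_ofReal_iff (Real.sqrt_nonneg _),
    Real.sqrt_le_sqrt_iff (integral_nonneg fun _ => by positivity)] at h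
  unfold dirichletEnergy hardyConstant
  rw [← integral_const_mul]
  refine le_of_eq_of_le ?_ h
  congr 1
  ext1 x
  rw [Real.norm_eq_abs, sq_abs]
  ring

/-! ### The eigenvalue equation -/

theorem exists_abs_le_of_tendsto_cocompact {X : Type*} [TopologicalSpace X] {f : X → ℝ}
    (hf : Continuous f) {a : ℝ} (ha : Tendsto f (cocompact X) (𝓝 a)) : ∃ M, ∀ x, |f x| ≤ M := by
  have h1 : ∀ᶠ x in cocompact X, |f x| < |a| + 1 :=
    ha.abs.eventually_lt_const (by linarith)
  obtain ⟨K, hK, hKs⟩ := mem_cocompact.1 h1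
  obtain ⟨C, hC⟩ := hK.exists_bound_of_continuousOn hf.continuousOn
  refine ⟨max C (|a| + 1), fun x => ?_⟩
  by_cases hx : x ∈ K
  · exact (hC x hx).trans (le_max_left _ _)
  · exact (le_of_lt (hKs hx)).trans (le_max_right _ _)

theorem integral_add_const_mul_add_const_mul {α : Type*} {mα : MeasurableSpace α} {μ : Measure α}
    {f g h : α → ℝ} (hf : Integrable f μ) (hg : Integrable g μ) (hh : Integrable h μ) (a b : ℝ) :
    ∫ x, (f x + a * g x + b * h x) ∂μ =
      (∫ x, f x ∂μ) + a * (∫ x, g x ∂μ) + b * ∫ x, h x ∂μ := by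
  have h1 : Integrable (fun x => f x + a * g x) μ := hf.add (hg.const_mul a)
  rw [integral_add h1 (hh.const_mul b), integral_add hf (hg.const_mul a), integral_const_mul,
    integral_const_mul]

section Forms

variable {N : ℕ} {m u v : EuclideanSpace ℝ (Fin N) → ℝ} {M : ℝ}
  {G K : EuclideanSpace ℝ (Fin N) → EuclideanSpace ℝ (Fin N)}

theorem hardyForm_eq (m u : EuclideanSpace ℝ (Fin N) → ℝ) :
    hardyForm N m u = ∫ x, m x * ((u x / ‖x‖) * (u x / ‖x‖)) := by
  unfold hardyForm
  congr 1
  ext1 x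
  ring

theorem HasD12Gradient.integrable_hardy (hN : 3 ≤ N) (hu : HasD12Gradient N u G)
    (hv : HasD12Gradient N v K) (hm : AEStronglyMeasurable m volume) (hM : ∀ x, |m x| ≤ M) :
    Integrable (fun x => m x * ((u x / ‖x‖) * (v x / ‖x‖))) volume :=
  ((hu.memLp_div_norm hN).integrable_mul (hv.memLp_div_norm hN)).bdd_mul hm
    (Eventually.of_forall hM)

theorem integrable_inner_of_memLp_two (hG : MemLp G 2 volume) (hK : MemLp K 2 volume) :
    Integrable (fun x => inner ℝ (G x) (K x)) volume := by
  refine (hG.norm.integrable_mul hK.norm).mono' (hG.1.inner hK.1)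
    (Eventually.of_forall fun x => ?_)
  exact norm_inner_le_norm _ _

theorem hardyForm_add_smul (hN : 3 ≤ N) (hu : HasD12Gradient N u G)
    (hv : HasD12Gradient N v K) (hm : AEStronglyMeasurable m volume) (hM : ∀ x, |m x| ≤ M)
    (t : ℝ) :
    hardyForm N m (fun x => u x + t * v x) = hardyForm N m u +
      2 * t * (∫ x, m x * ((u x / ‖x‖) * (v x / ‖x‖))) + t ^ 2 * hardyForm N m v := by
  have I1 := hu.integrable_hardy hN hu hm hM
  have I2 := hu.integrable_hardy hN hv hm hM
  have I3 := hv.integrable_hardy hN hv hm hM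
  rw [hardyForm_eq, hardyForm_eq, hardyForm_eq, ← integral_add_const_mul_add_const_mul I1 I2 I3]
  congr 1
  ext1 x
  ring

theorem dirichletEnergy_add_smul (hG : MemLp G 2 volume) (hK : MemLp K 2 volume) (t : ℝ) :
    dirichletEnergy N (fun x => G x + t • K x) = dirichletEnergy N G +
      2 * t * (∫ x, inner ℝ (G x) (K x)) + t ^ 2 * dirichletEnergy N K := by
  have I1 := (memLp_two_iff_integrable_sq_norm hG.1).1 hG
  have I2 := integrable_inner_of_memLp_two hG hK
  have I3 := (memLp_two_iff_integrable_sq_norm hK.1).1 hK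
  unfold dirichletEnergy
  rw [← integral_add_const_mul_add_const_mul I1 I2 I3]
  congr 1
  ext1 x
  dsimp only
  rw [norm_add_sq_real, inner_smul_right, norm_smul, mul_pow, Real.norm_eq_abs, sq_abs]
  ring

theorem principalEigenvalue_nonneg (N : ℕ) (m : EuclideanSpace ℝ (Fin N) → ℝ) :
    0 ≤ principalEigenvalue N m := by
  refine Real.sInf_nonneg ?_
  rintro t ⟨u, G, -, -, rfl⟩
  exact integral_nonneg fun x => by positivity

/-- The Rayleigh quotient inequality without the normalization of the denominator. -/
theorem principalEigenvalue_mul_hardyForm_le (hN : 3 ≤ N) (hu : HasD12Gradient N u G)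
    (hpos : 0 < hardyForm N m u) :
    principalEigenvalue N m * hardyForm N m u ≤ dirichletEnergy N G := by
  set H := hardyForm N m u with hH
  set c := (√H)⁻¹ with hc
  have hcH : c ^ 2 * H = 1 := by
    rw [hc, inv_pow, Real.sq_sqrt hpos.le, inv_mul_cancel₀ hpos.ne']
  -- The rescaling `c u` is written as `u + (c - 1) u` to make use of linearity.
  have hs := hu.add_smul hN hu (c - 1)
  have hsu : hardyForm N m (fun x => u x + (c - 1) * u x) = 1 := by
    refine Eq.trans ?_ hcH
    rw [hH]
    unfold hardyForm
    rw [← integral_const_mul]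
    congr 1
    ext1 x
    ring
  have hsG : dirichletEnergy N (fun x => G x + (c - 1) • G x) = c ^ 2 * dirichletEnergy N G := by
    unfold dirichletEnergy
    rw [← integral_const_mul]
    congr 1
    ext1 x
    have : G x + (c - 1) • G x = c • G x := by module
    dsimp only
    rw [this, norm_smul, mul_pow, Real.norm_eq_abs, sq_abs]
  have hle : principalEigenvalue N m ≤ c ^ 2 * dirichletEnergy N G := by
    rw [← hsG]
    refine csInf_le ⟨0, ?_⟩ ⟨_, _, hs, hsu, rfl⟩
    rintro t ⟨u, G, -, -, rfl⟩
    exact integral_nonneg fun x => by positivity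
  calc principalEigenvalue N m * H ≤ c ^ 2 * dirichletEnergy N G * H := by gcongr
    _ = (c ^ 2 * H) * dirichletEnergy N G := by ring
    _ = _ := by rw [hcH, one_mul]

/-- A minimizer of the Rayleigh quotient solves `-Δu = Λ_m m u / ‖x‖ ^ 2` weakly in `D^{1,2}`. -/
theorem weak_eigenvalue_equation (hN : 3 ≤ N) (hm : AEStronglyMeasurable m volume)
    (hM : ∀ x, |m x| ≤ M) (hu : HasD12Gradient N u G) (hpos : 0 < hardyForm N m u)
    (hmin : dirichletEnergy N G / hardyForm N m u = principalEigenvalue N m)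
    (hv : HasD12Gradient N v K) :
    ∫ x, inner ℝ (G x) (K x) =
      principalEigenvalue N m * ∫ x, m x * ((u x / ‖x‖) * (v x / ‖x‖)) := by
  set L := principalEigenvalue N m
  set B := ∫ x, inner ℝ (G x) (K x)
  set b := ∫ x, m x * ((u x / ‖x‖) * (v x / ‖x‖)) with hb
  have hE : dirichletEnergy N G = L * hardyForm N m u := by
    rw [← hmin, div_mul_cancel₀ _ hpos.ne']
  -- `g t` is the energy minus `L` times the potential term at `u + t v`. It is nonnegative near
  -- `t = 0`, where the potential term is still positive, and `g 0 = 0`.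
  let g : ℝ → ℝ := fun t => 2 * t * (B - L * b) +
    t ^ 2 * (dirichletEnergy N K - L * hardyForm N m v)
  have hder : HasDerivAt g (2 * (B - L * b)) 0 := by
    have := (((hasDerivAt_id (0 : ℝ)).const_mul 2).mul_const (B - L * b)).add
      (((hasDerivAt_id (0 : ℝ)).pow 2).mul_const (dirichletEnergy N K - L * hardyForm N m v))
    refine this.congr_deriv ?_
    simp
  have hloc : IsLocalMin g 0 := by
    have hc : ContinuousAt (fun t : ℝ => hardyForm N m u + 2 * t * b + t ^ 2 * hardyForm N m v) 0 :=
      by fun_prop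
    have := hc.eventually_const_lt (u := 0) (by simpa using hpos)
    filter_upwards [this] with t ht
    have h1 := hardyForm_add_smul hN hu hv hm hM t
    rw [← hb] at h1
    have h2 := principalEigenvalue_mul_hardyForm_le (m := m) hN (hu.add_smul hN hv t)
      (by rw [h1]; exact ht)
    rw [h1, dirichletEnergy_add_smul hu.2 hv.2 t, hE] at h2
    simp only [g]
    nlinarith
  have := hloc.hasDerivAt_eq_zero hder
  linarith

end Forms

/-! ### Smoothly truncated powers -/

/-- The bounded smooth substitute `(1 + t ^ 2) / (1 + κ t ^ 2)` for `1 + t ^ 2`. -/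
noncomputable def truncRatio (κ t : ℝ) : ℝ := (1 + t ^ 2) / (1 + κ * t ^ 2)

/-- The function `t ((1 + t ^ 2) / (1 + κ t ^ 2)) ^ r`, which is linear at infinity for `κ > 0` and
tends to `t (1 + t ^ 2) ^ r` as `κ → 0`. -/
noncomputable def truncPow (κ r t : ℝ) : ℝ := t * truncRatio κ t ^ r

/-- Half of the logarithmic derivative `t ∂ₜ log (truncRatio κ t)`. -/
noncomputable def truncSlope (κ t : ℝ) : ℝ :=
  (1 - κ) * t ^ 2 / ((1 + t ^ 2) * (1 + κ * t ^ 2))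

section Truncation

variable {κ : ℝ}

theorem truncRatio_pos (hκ : 0 < κ) (t : ℝ) : 0 < truncRatio κ t := by
  unfold truncRatio
  positivity

theorem truncRatio_le_one_add_sq (hκ : 0 < κ) (t : ℝ) : truncRatio κ t ≤ 1 + t ^ 2 := by
  unfold truncRatio
  exact div_le_self (by positivity) (by nlinarith [mul_nonneg hκ.le (sq_nonneg t)])

theorem truncRatio_le_inv (hκ : 0 < κ) (hκ1 : κ ≤ 1) (t : ℝ) : truncRatio κ t ≤ κ⁻¹ := by
  unfold truncRatio
  rw [div_le_iff₀ (by positivity), mul_add, ← mul_assoc, inv_mul_cancel₀ hκ.ne']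
  linarith [(one_le_inv₀ hκ).2 hκ1]

theorem truncSlope_nonneg (hκ : 0 < κ) (hκ1 : κ ≤ 1) (t : ℝ) : 0 ≤ truncSlope κ t := by
  have : 0 ≤ 1 - κ := by linarith
  unfold truncSlope
  positivity

theorem truncSlope_le_one (hκ : 0 < κ) (t : ℝ) : truncSlope κ t ≤ 1 := by
  unfold truncSlope
  rw [div_le_one (by positivity)]
  nlinarith [mul_nonneg hκ.le (sq_nonneg t), mul_nonneg hκ.le (sq_nonneg (t ^ 2)), sq_nonneg t]

theorem contDiff_truncPow (hκ : 0 < κ) (r : ℝ) : ContDiff ℝ ∞ (truncPow κ r) := by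
  have h1 : ∀ t : ℝ, 1 + κ * t ^ 2 ≠ 0 := fun t => by positivity
  have h2 : ContDiff ℝ ∞ (truncRatio κ) :=
    ContDiff.div (by fun_prop) (by fun_prop) h1
  exact contDiff_id.mul (h2.rpow_const_of_ne fun t => (truncRatio_pos hκ t).ne')

theorem truncPow_zero (κ r : ℝ) : truncPow κ r 0 = 0 := by simp [truncPow]

theorem deriv_truncPow (hκ : 0 < κ) (r t : ℝ) :
    deriv (truncPow κ r) t = truncRatio κ t ^ r * (1 + 2 * r * truncSlope κ t) := by
  have h0 : 1 + κ * t ^ 2 ≠ 0 := by positivity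
  have h1 : HasDerivAt (fun t : ℝ => 1 + t ^ 2) (2 * t) t := by
    simpa using (hasDerivAt_pow 2 t).const_add 1
  have h2 : HasDerivAt (fun t : ℝ => 1 + κ * t ^ 2) (κ * (2 * t)) t := by
    simpa using ((hasDerivAt_pow 2 t).const_mul κ).const_add 1
  have h3 : HasDerivAt (truncRatio κ) _ t := h1.div h2 h0
  have h4 := (hasDerivAt_id t).mul (h3.rpow_const (p := r) (Or.inl (truncRatio_pos hκ t).ne'))
  have h5 : deriv (truncPow κ r) t = _ := h4.deriv
  rw [h5, Real.rpow_sub_one (truncRatio_pos hκ t).ne']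
  simp only [id]
  generalize truncRatio κ t ^ r = P
  unfold truncRatio truncSlope
  have : 1 + t ^ 2 ≠ 0 := by positivity
  field_simp
  ring

theorem abs_deriv_truncPow_le (hκ : 0 < κ) (hκ1 : κ ≤ 1) {r : ℝ} (hr : 0 ≤ r) (t : ℝ) :
    |deriv (truncPow κ r) t| ≤ κ⁻¹ ^ r * (1 + 2 * r) := by
  have h0 := truncSlope_nonneg hκ hκ1 t
  have h1 := truncSlope_le_one hκ t
  have h2 := truncRatio_pos hκ t
  rw [deriv_truncPow hκ, abs_of_nonneg (by positivity)]
  have h3 : 2 * r * truncSlope κ t ≤ 2 * r := mul_le_of_le_one_right (by positivity) h1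
  exact mul_le_mul (Real.rpow_le_rpow h2.le (truncRatio_le_inv hκ hκ1 t) hr) (by linarith)
    (by positivity) (by positivity)

theorem tendsto_truncPow (r t : ℝ) :
    Tendsto (fun k : ℕ => truncPow (1 / ((k : ℝ) + 1)) r t) atTop
      (𝓝 (t * (1 + t ^ 2) ^ r)) := by
  have h1 : Tendsto (fun k : ℕ => 1 + 1 / ((k : ℝ) + 1) * t ^ 2) atTop (𝓝 1) := by
    simpa using (tendsto_one_div_add_atTop_nhds_zero_nat.mul_const (t ^ 2)).const_add 1
  have h2 : Tendsto (fun k : ℕ => truncRatio (1 / ((k : ℝ) + 1)) t) atTop (𝓝 (1 + t ^ 2)) := by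
    have := (tendsto_const_nhds (x := 1 + t ^ 2)).div h1 one_ne_zero
    rwa [div_one] at this
  exact (h2.rpow_const (Or.inl (by positivity))).const_mul t

end Truncation

/-! ### The energy estimate -/

/-- Comparison of the gradient `(1 + s a) x + y` of the truncated power with the pairing that
results from the test function. The constant in front of the pairing exceeds `1` only by `s ^ 2`. -/
theorem norm_sq_le_pairing {V : Type*} [NormedAddCommGroup V] [InnerProductSpace ℝ V] (x y : V)
    {s a δ : ℝ} (hs : 0 ≤ s) (hs1 : s ≤ 1) (ha : 0 ≤ a) (ha1 : a ≤ 1) (hδ : 0 < δ) :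
    (1 - 2 * δ) * ‖(1 + s * a) • x + y‖ ^ 2 ≤
      (1 + s ^ 2) * ((1 + 2 * s * a) * ‖x‖ ^ 2 + 2 * inner ℝ x y) +
        (2 * δ + δ⁻¹ + 1) * ‖y‖ ^ 2 := by
  rw [norm_add_sq_real, inner_smul_left, norm_smul, mul_pow, Real.norm_eq_abs, sq_abs]
  simp only [conj_trivial]
  have hI := abs_real_inner_le_norm x y
  have hX := norm_nonneg x
  have hY := norm_nonneg y
  set X := ‖x‖
  set Y := ‖y‖
  set I := inner ℝ x y
  have hsa : 0 ≤ s * a := mul_nonneg hs ha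
  have hsa1 : s * a ≤ 1 := mul_le_one₀ hs1 ha ha1
  have hss : s ^ 2 ≤ 1 := pow_le_one₀ hs hs1
  have h1 : (1 + s * a) ^ 2 * X ^ 2 ≤ (1 + s ^ 2) * (1 + 2 * s * a) * X ^ 2 := by
    gcongr
    have : a ^ 2 ≤ 1 := pow_le_one₀ ha ha1
    nlinarith [mul_nonneg (sq_nonneg s) hsa, mul_nonneg (sq_nonneg s) (sub_nonneg.2 this)]
  have h2 : 2 * (s * a - s ^ 2) * I ≤ 2 * (X * Y) := by
    have h3 : |s * a - s ^ 2| ≤ 1 := by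
      rw [abs_le]
      constructor <;> nlinarith [sq_nonneg s]
    have h4 : |(s * a - s ^ 2) * I| ≤ 1 * (X * Y) := by
      rw [abs_mul]
      exact mul_le_mul h3 hI (abs_nonneg _) zero_le_one
    linarith [le_abs_self ((s * a - s ^ 2) * I)]
  have h3 : 2 * (X * Y) ≤ δ * X ^ 2 + δ⁻¹ * Y ^ 2 := by
    have : δ * X ^ 2 + δ⁻¹ * Y ^ 2 - 2 * (X * Y) = δ⁻¹ * (δ * X - Y) ^ 2 := by
      field_simp
      ring
    have h5 : 0 ≤ δ⁻¹ * (δ * X - Y) ^ 2 := by positivity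
    linarith
  have h4 : X ^ 2 ≤ 2 * ((1 + s * a) ^ 2 * X ^ 2 + 2 * ((1 + s * a) * I) + Y ^ 2) + 2 * Y ^ 2 := by
    have h5 : -(X * Y) ≤ I := (abs_le.1 hI).1
    have h6 : (1 + s * a) * -(X * Y) ≤ (1 + s * a) * I := by gcongr
    have h7 : 1 * X ^ 2 ≤ (1 + s * a) ^ 2 * X ^ 2 := by
      gcongr
      exact one_le_pow₀ (by linarith)
    nlinarith [sq_nonneg ((1 + s * a) * X - 2 * Y)]
  have h5 := mul_le_mul_of_nonneg_left h4 hδ.le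
  nlinarith

/-- The growth of `t ^ 2 (1 + t ^ 2) ^ s` is subcritical as long as `2 (1 + s) ≤ q`. -/
theorem sq_mul_one_add_sq_rpow_le {q s : ℝ} (hq : 2 * (1 + s) ≤ q) (hq0 : 0 < q) (t : ℝ) :
    t ^ 2 * (1 + t ^ 2) ^ s ≤ 2 ^ (q / 2) * (1 + |t| ^ q) := by
  have h1 : (1 : ℝ) ≤ 1 + t ^ 2 := by linarith [sq_nonneg t]
  have h0 : (0 : ℝ) < 1 + t ^ 2 := by linarith
  calc t ^ 2 * (1 + t ^ 2) ^ s ≤ (1 + t ^ 2) * (1 + t ^ 2) ^ s := by gcongr; linarith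
    _ = (1 + t ^ 2) ^ (1 + s) := by rw [Real.rpow_add h0, Real.rpow_one]
    _ ≤ (1 + t ^ 2) ^ (q / 2) := Real.rpow_le_rpow_of_exponent_le h1 (by linarith)
    _ ≤ (2 * max 1 (t ^ 2)) ^ (q / 2) := by
        gcongr
        linarith [le_max_left 1 (t ^ 2), le_max_right 1 (t ^ 2)]
    _ = 2 ^ (q / 2) * max 1 (t ^ 2) ^ (q / 2) := by
        rw [Real.mul_rpow (by norm_num) (by positivity)]
    _ ≤ 2 ^ (q / 2) * (1 + |t| ^ q) := by
        gcongr
        have e : (t ^ 2) ^ (q / 2) = |t| ^ q := by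
          rw [← sq_abs, ← Real.rpow_natCast, ← Real.rpow_mul (abs_nonneg t)]
          congr 1
          push_cast
          ring
        have h2 : 0 ≤ |t| ^ q := by positivity
        rcases max_cases 1 (t ^ 2) with ⟨h, -⟩ | ⟨h, -⟩ <;> rw [h]
        · rw [Real.one_rpow]
          linarith
        · rw [e]
          linarith

theorem truncRatio_rpow_eq {κ : ℝ} (hκ : 0 < κ) (s t : ℝ) :
    truncRatio κ t ^ s = truncRatio κ t ^ (s / 2) * truncRatio κ t ^ (s / 2) := by
  rw [← Real.rpow_add (truncRatio_pos hκ t), add_halves]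

/-- Pointwise comparison of the energy density of `η * truncPow κ (s / 2) u` with the pairing of the
gradient of `u` and that of `η ^ 2 * truncPow κ s u`; here `g` and `e` are the values of the
gradients of `u` and `η`, and `t` is the value of `u`. -/
theorem truncPow_pairing {V : Type*} [NormedAddCommGroup V] [InnerProductSpace ℝ V] (g e : V)
    (η t : ℝ) {κ s δ q : ℝ} (hκ : 0 < κ) (hκ1 : κ ≤ 1) (hs : 0 ≤ s) (hs1 : s ≤ 1) (hδ : 0 < δ)
    (hq : 2 * (1 + s) ≤ q) (hq0 : 0 < q) :
    (1 - 2 * δ) *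
        ‖η • (deriv (truncPow κ (s / 2)) t • g) + truncPow κ (s / 2) t • e‖ ^ 2 ≤
      (1 + s ^ 2) *
        inner ℝ g ((η * η) • (deriv (truncPow κ s) t • g) + truncPow κ s t • ((2 * η) • e)) +
      (2 * δ + δ⁻¹ + 1) * (2 ^ (q / 2) * (1 + |t| ^ q) * ‖e‖ ^ 2) := by
  have key := norm_sq_le_pairing ((η * truncRatio κ t ^ (s / 2)) • g)
    ((t * truncRatio κ t ^ (s / 2)) • e) hs hs1
    (truncSlope_nonneg hκ hκ1 t) (truncSlope_le_one hκ t) hδ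
  have e3 : ‖(t * truncRatio κ t ^ (s / 2)) • e‖ ^ 2 ≤
      2 ^ (q / 2) * (1 + |t| ^ q) * ‖e‖ ^ 2 := by
    rw [norm_smul, mul_pow, Real.norm_eq_abs, sq_abs]
    gcongr
    refine le_trans ?_ (sq_mul_one_add_sq_rpow_le hq hq0 t)
    rw [mul_pow, sq (truncRatio κ t ^ (s / 2)), ← truncRatio_rpow_eq hκ]
    gcongr
    · exact (truncRatio_pos hκ _).le
    · exact truncRatio_le_one_add_sq hκ _
  simp only [deriv_truncPow hκ]
  unfold truncPow
  rw [truncRatio_rpow_eq hκ s]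
  set P := truncRatio κ t ^ (s / 2)
  set a := truncSlope κ t
  have e1 : η • ((P * (1 + 2 * (s / 2) * a)) • g) + (t * P) • e =
      (1 + s * a) • ((η * P) • g) + (t * P) • e := by
    module
  have e2 : inner ℝ g ((η * η) • ((P * P * (1 + 2 * s * a)) • g) + (t * (P * P)) • ((2 * η) • e)) =
      (1 + 2 * s * a) * ‖(η * P) • g‖ ^ 2 + 2 * inner ℝ ((η * P) • g) ((t * P) • e) := by
    rw [norm_smul, mul_pow, Real.norm_eq_abs, sq_abs, ← real_inner_self_eq_norm_sq]
    simp only [inner_add_right, inner_smul_left, inner_smul_right, conj_trivial]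
    ring
  rw [e1, e2]
  refine key.trans ?_
  gcongr

/-- Energy bound, uniform in the truncation parameter `κ`, for the truncated powers of an
eigenfunction outside a ball on which the potential stays below `θ` times the Hardy constant. -/
theorem exists_energy_bound {N : ℕ} (hN : 3 ≤ N) {m u η : EuclideanSpace ℝ (Fin N) → ℝ}
    {G : EuclideanSpace ℝ (Fin N) → EuclideanSpace ℝ (Fin N)} {L M θ s R : ℝ}
    (hm : AEStronglyMeasurable m volume) (hM : ∀ x, |m x| ≤ M) (hu : HasD12Gradient N u G)
    (heq : ∀ v K, HasD12Gradient N v K → ∫ x, inner ℝ (G x) (K x) =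
      L * ∫ x, m x * ((u x / ‖x‖) * (v x / ‖x‖)))
    (hθ0 : 0 ≤ θ) (hθ1 : θ < 1) (hmθ : ∀ x, R < ‖x‖ → L * m x ≤ θ * hardyConstant N)
    (hη : ContDiff ℝ ∞ η) (hη1 : ∀ x, |η x| ≤ 1) (hηc : HasCompactSupport (gradient η))
    (hη0 : ∀ x, ‖x‖ ≤ R → η x = 0)
    (hs : 0 < s) (hsθ : s ≤ (1 - θ) / 4) (hsN : 2 * (1 + s) ≤ sobolevExponent N) :
    ∃ C : ℝ, ∀ κ, 0 < κ → κ ≤ 1 → ∃ K, HasD12Gradient N (fun x => η x * truncPow κ (s / 2) (u x)) K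
      ∧ dirichletEnergy N K ≤ C := by
  set q := sobolevExponent N with hq
  have hq0 : 0 < q := sobolevExponent_pos hN
  -- With this weight and `s ≤ (1 - θ) / 4` the coefficient `1 - 2 δ - (1 + s ^ 2) θ` left after
  -- absorption is positive.
  set δ := (1 - θ) / 8 with hδ
  have hδ0 : 0 < δ := by rw [hδ]; linarith
  have hs1 : s ≤ 1 := by linarith
  set D := 2 * δ + δ⁻¹ + 1 with hD
  have hD0 : 0 < D := by positivity
  -- An integrable majorant, free of `κ`, of the term produced by the gradient of the cutoff.
  let Q : EuclideanSpace ℝ (Fin N) → ℝ := fun x =>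
    2 ^ (q / 2) * (1 + |u x| ^ q) * ‖gradient η x‖ ^ 2
  have hQ : Integrable Q volume := by
    have hc : Continuous fun x => ‖gradient η x‖ ^ 2 := hη.continuous_gradient.norm.pow 2
    have hcs : HasCompactSupport fun x => ‖gradient η x‖ ^ 2 :=
      hηc.comp_left (g := fun z => ‖z‖ ^ 2) (by simp)
    obtain ⟨B, hB⟩ := hc.bounded_above_of_compact_support hcs
    have h1 : Integrable (fun x => ‖gradient η x‖ ^ 2) volume :=
      hc.integrable_of_hasCompactSupport hcs
    have h2 : Integrable (fun x => |u x| ^ q) volume := by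
      have := hu.1.integrable_norm_rpow (by simpa using hq0) (by simp)
      rwa [ENNReal.toReal_ofReal hq0.le] at this
    have h3 : Integrable (fun x => ‖gradient η x‖ ^ 2 * |u x| ^ q) volume :=
      h2.bdd_mul hc.aestronglyMeasurable (Eventually.of_forall hB)
    refine ((h1.add h3).const_mul (2 ^ (q / 2))).congr (Eventually.of_forall fun x => ?_)
    simp only [Pi.add_apply, Q]
    ring
  have hgap : 0 < 1 - 2 * δ - (1 + s ^ 2) * θ := by
    have : s ^ 2 ≤ (1 - θ) / 4 := by nlinarith
    have h2 : s ^ 2 * θ ≤ (1 - θ) / 4 := by nlinarith [sq_nonneg s]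
    have h3 : 2 * δ = (1 - θ) / 4 := by rw [hδ]; ring
    nlinarith
  refine ⟨D * (∫ x, Q x) / (1 - 2 * δ - (1 + s ^ 2) * θ), fun κ hκ hκ1 => ?_⟩
  have hηη : ContDiff ℝ ∞ fun x => η x * η x := hη.mul hη
  have hηηg : gradient (fun x => η x * η x) = fun x => (2 * η x) • gradient η x := by
    ext1 x
    rw [gradient_mul (hη.differentiable (by simp) x) (hη.differentiable (by simp) x)]
    module
  have hηηc : HasCompactSupport (gradient fun x => η x * η x) := by
    rw [hηηg]
    refine hηc.mono fun x hx h0 => hx ?_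
    simp only [h0, smul_zero]
  have hw := (hu.comp hN (contDiff_truncPow hκ (s / 2)) (truncPow_zero _ _)
    (abs_deriv_truncPow_le hκ hκ1 (by positivity))).smooth_mul hN hη hη1 hηc
  have hv := (hu.comp hN (contDiff_truncPow hκ s) (truncPow_zero _ _)
    (abs_deriv_truncPow_le hκ hκ1 hs.le)).smooth_mul hN hηη (C := 1)
      (fun x => by rw [abs_mul]; exact mul_le_one₀ (hη1 x) (abs_nonneg _) (hη1 x))
      hηηc
  refine ⟨_, hw, ?_⟩
  set w := fun x => η x * truncPow κ (s / 2) (u x) with hw_def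
  set v := fun x => η x * η x * truncPow κ s (u x) with hv_def
  set Kw := fun x => η x • (deriv (truncPow κ (s / 2)) (u x) • G x) +
    truncPow κ (s / 2) (u x) • gradient η x with hKw
  set Kv := fun x => (η x * η x) • (deriv (truncPow κ s) (u x) • G x) +
    truncPow κ s (u x) • gradient (fun x => η x * η x) x with hKv
  have hpt : ∀ x, (1 - 2 * δ) * ‖Kw x‖ ^ 2 ≤ (1 + s ^ 2) * inner ℝ (G x) (Kv x) + D * Q x := by
    intro x
    have h := truncPow_pairing (G x) (gradient η x) (η x) (u x) hκ hκ1 hs.le hs1 hδ0 hsN hq0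
    have hx : Kv x = (η x * η x) • (deriv (truncPow κ s) (u x) • G x) +
        truncPow κ s (u x) • ((2 * η x) • gradient η x) :=
      congrArg (fun z => (η x * η x) • (deriv (truncPow κ s) (u x) • G x) +
        truncPow κ s (u x) • z) (congrFun hηηg x)
    rw [hx]
    exact h
  have huv : ∀ x, u x * v x = w x ^ 2 := by
    intro x
    simp only [hw_def, hv_def, truncPow, truncRatio_rpow_eq hκ s]
    ring
  have J1 := (memLp_two_iff_integrable_sq_norm hw.2.1).1 hw.2
  have J2 := integrable_inner_of_memLp_two hu.2 hv.2
  have hint := integral_mono (J1.const_mul (1 - 2 * δ))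
    ((J2.const_mul (1 + s ^ 2)).add (hQ.const_mul D)) hpt
  simp only [Pi.add_apply] at hint
  rw [integral_const_mul, integral_add (J2.const_mul (1 + s ^ 2)) (hQ.const_mul D),
    integral_const_mul, integral_const_mul, heq _ _ hv] at hint
  have hpot : L * ∫ x, m x * ((u x / ‖x‖) * (v x / ‖x‖)) ≤ θ * dirichletEnergy N Kw := by
    calc L * ∫ x, m x * ((u x / ‖x‖) * (v x / ‖x‖))
        = ∫ x, L * (m x * ((u x / ‖x‖) * (v x / ‖x‖))) := (integral_const_mul _ _).symm
      _ ≤ ∫ x, θ * hardyConstant N * (w x / ‖x‖) ^ 2 := by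
          refine integral_mono ((hu.integrable_hardy hN hv hm hM).const_mul L)
            ((hw.memLp_div_norm hN).integrable_sq.const_mul _) fun x => ?_
          have e : L * (m x * ((u x / ‖x‖) * (v x / ‖x‖))) = L * m x * (w x / ‖x‖) ^ 2 := by
            rw [div_mul_div_comm, huv, div_pow, sq ‖x‖, mul_assoc]
          dsimp only
          rw [e]
          rcases le_or_gt ‖x‖ R with hx | hx
          · simp [hw_def, hη0 x hx]
          · exact mul_le_mul_of_nonneg_right (hmθ x hx) (sq_nonneg _)
      _ = θ * (hardyConstant N * ∫ x, (w x / ‖x‖) ^ 2) := by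
          rw [integral_const_mul, mul_assoc]
      _ ≤ θ * dirichletEnergy N Kw := mul_le_mul_of_nonneg_left (hw.hardy hN) hθ0
  rw [le_div_iff₀ hgap]
  have hE : ∫ x, ‖Kw x‖ ^ 2 = dirichletEnergy N Kw := rfl
  rw [hE] at hint
  have := mul_le_mul_of_nonneg_left hpot (by positivity : 0 ≤ 1 + s ^ 2)
  linarith

/-! ### Higher integrability at infinity -/

theorem exists_smooth_cutoff (N : ℕ) {R : ℝ} (hR : 0 < R) :
    ∃ η : EuclideanSpace ℝ (Fin N) → ℝ, ContDiff ℝ ∞ η ∧ (∀ x, |η x| ≤ 1) ∧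
      HasCompactSupport (gradient η) ∧ (∀ x, ‖x‖ ≤ R → η x = 0) ∧
      ∀ x, 2 * R ≤ ‖x‖ → η x = 1 := by
  let f : ContDiffBump (0 : EuclideanSpace ℝ (Fin N)) := ⟨R, 2 * R, hR, by linarith⟩
  have hg : gradient (fun x => 1 - f x) = fun x => -gradient f x := by
    ext1 x
    simp only [gradient, fderiv_const_sub, map_neg]
  refine ⟨fun x => 1 - f x, contDiff_const.sub f.contDiff, fun x => ?_, ?_, fun x hx => ?_,
    fun x hx => ?_⟩
  · rw [abs_le]
    constructor <;> linarith [f.nonneg (x := x), f.le_one (x := x)]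
  · rw [hg]
    exact f.hasCompactSupport.gradient.neg
  · change 1 - f x = 0
    rw [f.one_of_mem_closedBall (by simpa using hx), sub_self]
  · change 1 - f x = 1
    rw [f.zero_of_le_dist (by simpa using hx), sub_zero]

theorem principalEigenvalue_mul_lt_hardyConstant {N : ℕ} (hN : 3 ≤ N)
    {m : EuclideanSpace ℝ (Fin N) → ℝ} {a : ℝ} (ha : 0 < a)
    (h : ENNReal.ofReal (principalEigenvalue N m) <
      ENNReal.ofReal (hardyConstant N) *
        min (ENNReal.ofReal (m 0))⁻¹ (ENNReal.ofReal a)⁻¹) :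
    principalEigenvalue N m * a < hardyConstant N := by
  have h1 := h.trans_le (mul_le_mul_right (min_le_right _ _) _)
  rw [← ENNReal.ofReal_inv_of_pos ha, ← ENNReal.ofReal_mul (hardyConstant_pos hN).le,
    ENNReal.ofReal_lt_ofReal_iff (mul_pos (hardyConstant_pos hN) (inv_pos.2 ha)),
    ← div_eq_mul_inv, lt_div_iff₀ ha] at h1
  exact h1

/-- The limit of the truncated powers lies in `L^{2*}`, by the Sobolev inequality and Fatou's
lemma. -/
theorem memLp_mul_one_add_sq_rpow {N : ℕ} (hN : 3 ≤ N)
    {u η : EuclideanSpace ℝ (Fin N) → ℝ} {s C : ℝ}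
    (hu : AEStronglyMeasurable u volume) (hη : Continuous η)
    (hC : ∀ κ, 0 < κ → κ ≤ 1 → ∃ K, HasD12Gradient N (fun x => η x * truncPow κ (s / 2) (u x)) K
      ∧ dirichletEnergy N K ≤ C) :
    MemLp (fun x => η x * (u x * (1 + u x ^ 2) ^ (s / 2)))
      (ENNReal.ofReal (sobolevExponent N)) volume := by
  obtain ⟨S, hS, hSob⟩ := exists_sobolev_const hN
  have hκ : ∀ k : ℕ, (0 : ℝ) < 1 / ((k : ℝ) + 1) := fun k => by positivity
  have hκ1 : ∀ k : ℕ, 1 / ((k : ℝ) + 1) ≤ 1 := fun k => by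
    rw [div_le_one (by positivity)]
    linarith [(Nat.cast_nonneg k : (0 : ℝ) ≤ k)]
  choose K hK hKC using fun k : ℕ => hC _ (hκ k) (hκ1 k)
  have hbound : ∀ k : ℕ, eLpNorm (fun x => η x * truncPow (1 / ((k : ℝ) + 1)) (s / 2) (u x))
      (ENNReal.ofReal (sobolevExponent N)) volume ≤ S * ENNReal.ofReal (√C) := by
    intro k
    refine (hSob _ _ (hK k)).trans ?_
    rw [(hK k).2.eLpNorm_two_eq]
    exact mul_le_mul_right (ENNReal.ofReal_le_ofReal (Real.sqrt_le_sqrt (hKC k))) _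
  have hm : Continuous fun t : ℝ => t * (1 + t ^ 2) ^ (s / 2) :=
    continuous_id.mul ((by fun_prop : Continuous fun t : ℝ => 1 + t ^ 2).rpow_const
      fun t => Or.inl (by positivity))
  refine ⟨hη.aestronglyMeasurable.mul (hm.comp_aestronglyMeasurable hu), ?_⟩
  have hF := Lp.eLpNorm_lim_le_liminf_eLpNorm (p := ENNReal.ofReal (sobolevExponent N))
    (fun k => (hK k).1.1) (fun x => η x * (u x * (1 + u x ^ 2) ^ (s / 2)))
    (Eventually.of_forall fun x => (tendsto_truncPow (s / 2) (u x)).const_mul (η x))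
  refine hF.trans_lt (lt_of_le_of_lt ?_ (ENNReal.mul_lt_top hS.lt_top ENNReal.ofReal_lt_top :
    S * ENNReal.ofReal (√C) < ⊤))
  exact (liminf_le_liminf (Eventually.of_forall hbound)).trans (by simp)

theorem memLp_of_memLp_mul_one_add_sq_rpow {α : Type*} {mα : MeasurableSpace α} {μ : Measure α}
    {u : α → ℝ} {q s : ℝ} (hs : 0 < s) (hu : AEStronglyMeasurable u μ)
    (h : MemLp (fun x => u x * (1 + u x ^ 2) ^ (s / 2)) (ENNReal.ofReal q) μ) :
    MemLp u (ENNReal.ofReal (q * (1 + s))) μ := by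
  have h1s : 0 < 1 + s := by linarith
  rw [← memLp_norm_rpow_iff (q := ENNReal.ofReal (1 + s)) hu (by simpa using h1s) (by simp),
    ENNReal.toReal_ofReal h1s.le, ← ENNReal.ofReal_div_of_pos h1s, mul_div_cancel_right₀ _ h1s.ne']
  refine h.mono ((Real.continuous_rpow_const h1s.le).comp_aestronglyMeasurable hu.norm)
    (Eventually.of_forall fun x => ?_)
  have h0 : 0 ≤ |u x| := abs_nonneg _
  have hp : (0 : ℝ) < 1 + u x ^ 2 := by positivity
  rw [norm_mul, Real.norm_eq_abs, Real.norm_eq_abs, Real.norm_eq_abs,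
    abs_of_nonneg (Real.rpow_nonneg h0 _), abs_of_nonneg (Real.rpow_nonneg hp.le _),
    Real.rpow_add_of_nonneg h0 zero_le_one hs.le, Real.rpow_one]
  gcongr
  have e : |u x| ^ s = (u x ^ 2) ^ (s / 2) := by
    rw [← sq_abs, ← Real.rpow_natCast, ← Real.rpow_mul h0]
    congr 1
    push_cast
    ring
  rw [e]
  exact Real.rpow_le_rpow (sq_nonneg _) (by linarith) (by positivity)

/-- The reciprocals `1 / m(0)` and `1 / m(∞)` are taken in `[0, ∞]`, with `1 / m(0) = ∞` if
`m(0) ≤ 0`. -/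
theorem mainTheorem10 (N : ℕ) (hN : 3 ≤ N)
    (m : EuclideanSpace ℝ (Fin N) → ℝ) (hm : Continuous m)
    (mInf : ℝ) (hmInf : Tendsto m (cocompact (EuclideanSpace ℝ (Fin N))) (𝓝 mInf))
    (hmInf_pos : 0 < mInf)
    (hΛ : ENNReal.ofReal (principalEigenvalue N m) <
      ENNReal.ofReal (hardyConstant N) *
        min (ENNReal.ofReal (m 0))⁻¹ (ENNReal.ofReal mInf)⁻¹)
    (φ : EuclideanSpace ℝ (Fin N) → ℝ) (hφ : IsPrincipalEigenfunction N m φ) :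
    ∃ δ : ℝ, 0 < δ ∧ ∃ R : ℝ, 0 < R ∧
      MemLp φ (ENNReal.ofReal (sobolevExponent N * (1 + δ)))
        (volume.restrict (Metric.ball (0 : EuclideanSpace ℝ (Fin N)) R)ᶜ) := by
  have h3 : (3 : ℝ) ≤ N := by exact_mod_cast hN
  obtain ⟨G, hG, hpos, hmin⟩ := hφ.minimizer
  obtain ⟨M, hM⟩ := exists_abs_le_of_tendsto_cocompact hm hmInf
  set L := principalEigenvalue N m
  set h := hardyConstant N with hh
  have hh0 : 0 < h := hardyConstant_pos hN
  have hL0 : 0 ≤ L := principalEigenvalue_nonneg N m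
  have hlt : L * mInf < h := principalEigenvalue_mul_lt_hardyConstant hN hmInf_pos hΛ
  -- `θ` lies strictly between `L * mInf / h` and `1`.
  set θ := (L * mInf / h + 1) / 2 with hθ
  have hq1 : L * mInf / h < 1 := (div_lt_one hh0).2 hlt
  have hq0 : 0 ≤ L * mInf / h := by positivity
  have hθ0 : 0 ≤ θ := by linarith
  have hθ1 : θ < 1 := by linarith
  have hθh : L * mInf < θ * h := by
    rw [← div_lt_iff₀ hh0]
    linarith
  obtain ⟨r, hr⟩ := Metric.closedBall_compl_subset_of_mem_cocompact
    ((hmInf.const_mul L).eventually_lt_const hθh) (0 : EuclideanSpace ℝ (Fin N))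
  set R := max r 1
  have hR : 0 < R := lt_of_lt_of_le one_pos (le_max_right _ _)
  have hmθ : ∀ x, R < ‖x‖ → L * m x ≤ θ * h := fun x hx => by
    refine le_of_lt (hr ?_)
    simpa using (le_max_left r 1).trans_lt hx
  obtain ⟨η, hη, hη1, hηc, hη0, hηR⟩ := exists_smooth_cutoff N hR
  -- `2 (1 + 2 / (N - 2)) = 2*` limits the gain of integrability in one step.
  set s := min ((1 - θ) / 4) (2 / ((N : ℝ) - 2)) with hs
  have hN2 : (0 : ℝ) < N - 2 := by linarith
  have hs0 : 0 < s := lt_min (by linarith) (by positivity)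
  have hsN : 2 * (1 + s) ≤ sobolevExponent N := by
    have h1 : s ≤ 2 / ((N : ℝ) - 2) := min_le_right _ _
    have h2 : sobolevExponent N = 2 * (1 + 2 / ((N : ℝ) - 2)) := by
      unfold sobolevExponent
      field_simp
      ring
    rw [h2]
    linarith
  obtain ⟨C, hC⟩ := exists_energy_bound hN hm.aestronglyMeasurable hM hG
    (fun v K hv => weak_eigenvalue_equation hN hm.aestronglyMeasurable hM hG hpos hmin hv)
    hθ0 hθ1 hmθ hη hη1 hηc hη0 hs0 (min_le_left _ _) hsN
  have hW := (memLp_mul_one_add_sq_rpow hN hG.1.1 hη.continuous hC).restrict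
    (Metric.ball (0 : EuclideanSpace ℝ (Fin N)) (2 * R))ᶜ
  refine ⟨s, hs0, 2 * R, by linarith, ?_⟩
  refine memLp_of_memLp_mul_one_add_sq_rpow hs0 hG.1.1.restrict
    (hW.ae_eq ?_)
  filter_upwards [ae_restrict_mem Metric.isOpen_ball.measurableSet.compl] with x hx
  rw [hηR x (by simpa using hx), one_mul]
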